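/- Let $\mathbb{D}$ be the open unit disk in $\mathbb{C}$, let $dA=\frac1\pi\,dx\,dy$ be the normalized area measure on $\mathbb{D}$, and let $L^p(\mathbb{D})$, $1\le p\le\infty$, be the complex $L^p$ space of $dA$. For $z\in\mathbb{D}$ put $$\mathfrak{J}_0^*[f](z)=\int_{\mathbb{D}}\frac{\bar w}{1-\bar w z}\,f(w)\,dA(w).$$ For $2<p\le\infty$ let $q=\frac{p}{p-1}$ (so $q\in[1,2)$, and $q=1$ when $p=\infty$), and let $$A(p)=\frac{2}{2+q}\;{}_3F_2\!\left[1+\tfrac q2,\tfrac q2,\tfrac q2;\,1,\,2+\tfrac q2;\,1\right],$$ where ${}_3F_2[a_1,a_2,a_3;b_1,b_2;x]=\sum_{n\ge0}\frac{(a_1)_n(a_2)_n(a_3)_n}{(b_1)_n(b_2)_n}\frac{x^n}{n!}$ for $|x|<1$, $(a)_n=a(a+1)\cdots(a+n-1)$, $(a)_0=1$, and the value at $x=1$ is the continuous extension as $x\to1^-$. Then for these parameters the series converges at $x=1$, with sum equal to that value; for every $f\in L^p(\mathbb{D})$ the integral defining $\mathfrak{J}_0^*[f](z)$ converges absolutely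 for all $z\in\mathbb{D}$ and $\mathfrak{J}_0^*[f]\in L^\infty(\mathbb{D})$; and $$\|\mathfrak{J}_0^*\|_{L^p(\mathbb{D})\to L^\infty(\mathbb{D})}:=\sup\{\|\mathfrak{J}_0^*[f]\|_\infty:\|f\|_p=1\}=A(p)^{1-\frac1p}$$ (with $1-\frac1p=1$ when $p=\infty$). In particular, for $p=\infty$, $$\|\mathfrak{J}_0^*\|_{L^\infty(\mathbb{D})\to L^\infty(\mathbb{D})}=\frac{1+2G}{\pi},$$ where $G=\sum_{n\ge0}\frac{(-1)^n}{(2n+1)^2}$ is Catalan's constant. -/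

import Mathlib

open MeasureTheory Set Filter Topology
open scoped ENNReal ComplexConjugate

/-- The normalized area measure `dA = (1/π) dx dy` on the open unit disk, as a measure on `ℂ`
that gives no mass to the complement of the disk. -/
noncomputable def diskArea : Measure ℂ :=
  ENNReal.ofReal (1 / Real.pi) • volume.restrict (Metric.ball (0 : ℂ) 1)

/-- The integral kernel `w̄ / (1 - w̄ z)`. -/
noncomputable def adjKernel (z w : ℂ) : ℂ := conj w / (1 - conj w * z)

/-- The operator `J₀^*[f](z) = ∫_D w̄ f(w) / (1 - w̄ z) dA(w)`. -/
noncomputable def adjJ (f : ℂ → ℂ) (z : ℂ) : ℂ := ∫ w, adjKernel z w * f w ∂diskArea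

/-- The norm of `J₀^*` from `L^p(D)` to `L^∞(D)`, as an extended nonnegative real:
`sup {‖J₀^* f‖_∞ : f ∈ L^p(D), ‖f‖_p = 1}`. -/
noncomputable def adjJNorm (p : ℝ≥0∞) : ℝ≥0∞ :=
  sSup {c : ℝ≥0∞ | ∃ f : ℂ → ℂ, MemLp f p diskArea ∧ eLpNorm f p diskArea = 1 ∧
    c = eLpNorm (adjJ f) ∞ diskArea}

/-- The `n`-th coefficient `(a₁)_n ⋯ (a_r)_n / ((b₁)_n ⋯ (b_s)_n n!)` of the generalized
hypergeometric series, `(a)_n` being the rising factorial. -/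
noncomputable def hypCoeff (a b : List ℝ) (n : ℕ) : ℝ :=
  (a.map fun c => (ascPochhammer ℝ n).eval c).prod /
    ((b.map fun c => (ascPochhammer ℝ n).eval c).prod * (n.factorial : ℝ))

/-- The sum of the generalized hypergeometric series `_rF_s[a; b; x]`. -/
noncomputable def hypF (a b : List ℝ) (x : ℝ) : ℝ := ∑' n : ℕ, hypCoeff a b n * x ^ n

/-- Upper parameters `1 + q/2, q/2, q/2`. -/
noncomputable def upperParams (q : ℝ) : List ℝ := [1 + q / 2, q / 2, q / 2]

/-- Lower parameters `1, 2 + q/2`. -/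
noncomputable def lowerParams (q : ℝ) : List ℝ := [1, 2 + q / 2]

/-- The constant `2 ₃F₂[1 + q/2, q/2, q/2; 1, 2 + q/2; 1] / (2 + q)`. -/
noncomputable def constA (q : ℝ) : ℝ := 2 * hypF (upperParams q) (lowerParams q) 1 / (2 + q)

/-- Catalan's constant `G = ∑ (-1)^n / (2n+1)^2`. -/
noncomputable def catalanConst : ℝ := ∑' n : ℕ, (-1 : ℝ) ^ n / (2 * (n : ℝ) + 1) ^ 2

/-!
With `q` the exponent conjugate to `p`, the kernel `k_z(w) = w̄ / (1 - w̄ z)` satisfies, by Hölder's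
inequality and its equality case, `sup {|J₀^* f (z)| : ‖f‖_p = 1} = ‖k_z‖_q` for each `z` in the
disk; the extremal functions are `conj k_z * |k_z|^(q - 2)`, up to a factor, for `p < ∞` and the
conjugate phase of `k_z` for `p = ∞` (`exists_extremal`, `exists_extremal_top`). Since `J₀^* f` is
continuous on the disk, its essential supremum is its supremum, so the operator norm is
`sup_z ‖k_z‖_q`.

In polar coordinates, Parseval's identity on circles (`hasSum_circle_integral`) applied to
`|1 - w̄ z|^(-q) = |(1 - w̄ z)^(-q/2)|²` gives
`∫ |k_z|^q dA = ∑ ((q/2)_n / n!)² |z|^(2n) / (n + 1 + q/2)` (`lintegral_enorm_adjKernel_rpow`).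
The coefficients are nonnegative and, up to a constant factor, those of the `₃F₂` series; they are
summable exactly because `q < 2` (`summable_kernelCoeff`). So `‖k_z‖_q^q` increases with `|z|` and
tends to `constA q` as `|z| → 1`, by Abel's theorem.

For `q = 1` put `c_n = (1/2)_n / n!`, so that `constA 1 = ∑ c_n² / (n + 3/2)`. A telescoping sum,
whose limit is given by Wallis' product, reduces this to `1/π + (1/2) ∑ c_n² / (2n + 1)`
(`tsum_kernelCoeff_half`). As `c_n = (2/π) ∫ sin^(2n)` over `(0, π/2)`, the arcsine series turns
the remaining sum into `(2/π) ∫ θ / sin θ dθ`; the substitution `θ = 2 arctan t` makes the integral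
`2 ∫ arctan t / t dt` over `(0, 1)`, which is `2G` by the arctangent series.
-/

/-! ### The coefficients of `(1 - u)^(-s)` -/

/-- The Taylor coefficient `(s)_n / n!` of `(1 - u)^(-s)`. -/
noncomputable def binomCoeff (s : ℝ) (n : ℕ) : ℝ :=
  (ascPochhammer ℝ n).eval s / (n.factorial : ℝ)

lemma binomCoeff_zero (s : ℝ) : binomCoeff s 0 = 1 := by simp [binomCoeff]

lemma binomCoeff_succ (s : ℝ) (n : ℕ) :
    binomCoeff s (n + 1) = binomCoeff s n * ((s + n) / (n + 1)) := by
  unfold binomCoeff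
  rw [ascPochhammer_succ_eval, Nat.factorial_succ]
  push_cast
  have : (n.factorial : ℝ) ≠ 0 := by positivity
  field_simp

lemma binomCoeff_nonneg {s : ℝ} (hs : 0 ≤ s) (n : ℕ) : 0 ≤ binomCoeff s n := by
  induction n with
  | zero => simp [binomCoeff_zero]
  | succ n ih => rw [binomCoeff_succ]; positivity

lemma binomCoeff_eq_choose (s : ℝ) (n : ℕ) : binomCoeff s n = Ring.choose (s + n - 1) n := by
  rw [← Ring.multichoose_eq, binomCoeff, div_eq_iff (by positivity), mul_comm]
  have h := Ring.factorial_nsmul_multichoose_eq_ascPochhammer s n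
  rw [nsmul_eq_mul, Polynomial.ascPochhammer_smeval_cast,
    Polynomial.ascPochhammer_smeval_eq_eval] at h
  exact h.symm

lemma hasSum_binomCoeff_complex (s : ℝ) {u : ℂ} (hu : ‖u‖ < 1) :
    HasSum (fun n => (binomCoeff s n : ℂ) * u ^ n) (1 / (1 - u) ^ (s : ℂ)) := by
  have h := (Complex.one_div_one_sub_cpow_hasFPowerSeriesOnBall_zero (s : ℂ)).hasSum
    (y := u) (by
      rw [Metric.mem_eball, edist_zero_right, ← ofReal_norm, ENNReal.ofReal_lt_one]
      exact hu)
  rw [zero_add] at h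
  convert! h using 2 with n
  rw [binomCoeff_eq_choose, Complex.ofReal_choose]
  simp [mul_comm]

lemma hasSum_binomCoeff (s : ℝ) {x : ℝ} (hx : |x| < 1) :
    HasSum (fun n => binomCoeff s n * x ^ n) (1 / (1 - x) ^ s) := by
  have h := (Real.one_div_one_sub_rpow_hasFPowerSeriesOnBall_zero s).hasSum
    (y := x) (by
      rw [Metric.mem_eball, edist_zero_right, ← ofReal_norm, ENNReal.ofReal_lt_one]
      exact hx)
  rw [zero_add] at h
  convert! h using 2 with n
  rw [binomCoeff_eq_choose]
  simp [mul_comm]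

/-- With `s = q / 2`, this is the coefficient of `|z|^(2n)` in `∫ |w / (1 - w̄ z)|^q dA(w)`. -/
noncomputable def kernelCoeff (s : ℝ) (n : ℕ) : ℝ := binomCoeff s n ^ 2 / (n + 1 + s)

lemma kernelCoeff_nonneg {s : ℝ} (hs : 0 ≤ s) (n : ℕ) : 0 ≤ kernelCoeff s n := by
  unfold kernelCoeff; positivity

/-- The squares `d n = binomCoeff s n ^ 2` satisfy `(1 - s) * d n / (n + 1) ≤ d n - d (n + 1)`,
so the sum telescopes. -/
lemma summable_kernelCoeff {s : ℝ} (hs : 0 ≤ s) (hs1 : s < 1) : Summable (kernelCoeff s) := by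
  refine summable_of_sum_range_le (c := 1 / (1 - s)) (kernelCoeff_nonneg hs) fun N => ?_
  have key : ∀ n, (1 - s) * kernelCoeff s n ≤ binomCoeff s n ^ 2 - binomCoeff s (n + 1) ^ 2 := by
    intro n
    have hn : (0 : ℝ) ≤ n := n.cast_nonneg
    have h1 : (1 - s) * (1 / (n + 1 + s)) ≤ 1 - ((s + n) / (n + 1)) ^ 2 := by
      have h2 : (1 - s) * (1 / (n + 1 + s)) ≤ (1 - s) * (1 / (n + 1)) := by
        refine mul_le_mul_of_nonneg_left ?_ (by linarith)
        exact one_div_le_one_div_of_le (by positivity) (by linarith)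
      have h3 : (s + n) / (n + 1) ≤ 1 := by rw [div_le_one (by positivity)]; linarith
      have h4 : (0 : ℝ) ≤ (s + n) / (n + 1) := by positivity
      have h5 : (1 - s) * (1 / (n + 1)) = 1 - (s + n) / (n + 1) := by field_simp; ring
      nlinarith
    rw [binomCoeff_succ, kernelCoeff, mul_pow]
    calc _ = binomCoeff s n ^ 2 * ((1 - s) * (1 / (n + 1 + s))) := by ring
      _ ≤ binomCoeff s n ^ 2 * (1 - ((s + n) / (n + 1)) ^ 2) := by gcongr
      _ = _ := by ring
  rw [le_div_iff₀ (by linarith), mul_comm, Finset.mul_sum]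
  calc _ ≤ ∑ n ∈ Finset.range N, (binomCoeff s n ^ 2 - binomCoeff s (n + 1) ^ 2) :=
        Finset.sum_le_sum fun n _ => key n
    _ = 1 - binomCoeff s N ^ 2 := by rw [Finset.sum_range_sub', binomCoeff_zero]; ring
    _ ≤ 1 := by nlinarith [sq_nonneg (binomCoeff s N)]

/-! ### The hypergeometric series -/

lemma ascPochhammer_eval_add_one_mul {a : ℝ} (n : ℕ) :
    (ascPochhammer ℝ n).eval (a + 1) * a = (ascPochhammer ℝ n).eval a * (a + n) := by
  have h := ascPochhammer_succ_eval n a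
  rw [ascPochhammer_succ_left, Polynomial.eval_mul, Polynomial.eval_comp] at h
  simpa [mul_comm] using h

lemma hypCoeff_eq_kernelCoeff {q : ℝ} (hq : 0 < q) (n : ℕ) :
    hypCoeff (upperParams q) (lowerParams q) n = (1 + q / 2) * kernelCoeff (q / 2) n := by
  have h := ascPochhammer_eval_add_one_mul (a := 1 + q / 2) n
  rw [show 1 + q / 2 + 1 = 2 + q / 2 by ring] at h
  have h2 : 0 < (ascPochhammer ℝ n).eval (2 + q / 2) := ascPochhammer_pos n _ (by positivity)
  simp only [hypCoeff, upperParams, lowerParams, kernelCoeff, binomCoeff, List.map_cons,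
    List.map_nil, List.prod_cons, List.prod_nil, mul_one, ascPochhammer_eval_one]
  have h3 : (n.factorial : ℝ) ≠ 0 := by positivity
  have h4 : (n : ℝ) + 1 + q / 2 ≠ 0 := by positivity
  rw [mul_div_assoc', div_eq_div_iff (by positivity) h4]
  generalize (ascPochhammer ℝ n).eval (2 + q / 2) = x at *
  generalize (ascPochhammer ℝ n).eval (1 + q / 2) = y at *
  generalize (ascPochhammer ℝ n).eval (q / 2) = t at *
  field_simp
  linear_combination (-2 * t ^ 2) * h

lemma hypF_eq_tsum_kernelCoeff {q : ℝ} (hq : 0 < q) (x : ℝ) :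
    hypF (upperParams q) (lowerParams q) x =
      (1 + q / 2) * ∑' n, kernelCoeff (q / 2) n * x ^ n := by
  simp only [hypF, hypCoeff_eq_kernelCoeff hq, mul_assoc, tsum_mul_left]

lemma constA_eq_tsum_kernelCoeff {q : ℝ} (hq : 0 < q) :
    constA q = ∑' n, kernelCoeff (q / 2) n := by
  simp only [constA, hypF_eq_tsum_kernelCoeff hq, one_pow, mul_one]
  field_simp

lemma tendsto_tsum_kernelCoeff {s : ℝ} (hs : 0 ≤ s) (hs1 : s < 1) :
    Tendsto (fun x : ℝ => ∑' n, kernelCoeff s n * x ^ n) (𝓝[<] 1) (𝓝 (∑' n, kernelCoeff s n)) :=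
  Real.tendsto_tsum_powerSeries_nhdsWithin_lt
    (summable_kernelCoeff hs hs1).hasSum.tendsto_sum_nat

lemma summable_kernelCoeff_mul_pow {s : ℝ} (hs : 0 ≤ s) (hs1 : s < 1) {x : ℝ} (hx : 0 ≤ x)
    (hx1 : x ≤ 1) : Summable fun n => kernelCoeff s n * x ^ n :=
  (summable_kernelCoeff hs hs1).of_nonneg_of_le
    (fun n => mul_nonneg (kernelCoeff_nonneg hs n) (by positivity))
    fun n => mul_le_of_le_one_right (kernelCoeff_nonneg hs n) (pow_le_one₀ hx hx1)

lemma hypergeometric_summable_and_tendsto {q : ℝ} (hq : 0 < q) (hq2 : q < 2) :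
    Summable (fun n : ℕ => hypCoeff (upperParams q) (lowerParams q) n * (1 : ℝ) ^ n) ∧
      Tendsto (hypF (upperParams q) (lowerParams q)) (𝓝[<] 1)
        (𝓝 (hypF (upperParams q) (lowerParams q) 1)) := by
  have hs : 0 ≤ q / 2 := by positivity
  have hs1 : q / 2 < 1 := by linarith
  constructor
  · simp only [hypCoeff_eq_kernelCoeff hq, one_pow, mul_one]
    exact (summable_kernelCoeff hs hs1).mul_left _
  · have h := (tendsto_tsum_kernelCoeff hs hs1).const_mul (1 + q / 2)
    rw [funext (hypF_eq_tsum_kernelCoeff hq)]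
    simpa using h

/-! ### Circle means -/

lemma integral_exp_int_mul_I (k : ℤ) :
    ∫ θ in (-Real.pi)..Real.pi, Complex.exp (k * (θ * Complex.I)) =
      if k = 0 then (2 * Real.pi : ℂ) else 0 := by
  split_ifs with hk
  · simp [hk]
    ring
  · have hc : (k : ℂ) * Complex.I ≠ 0 := by simp [hk]
    have h : ∀ θ : ℝ, (k : ℂ) * (θ * Complex.I) = k * Complex.I * θ := fun θ => by ring
    simp only [h]
    rw [integral_exp_mul_complex hc, div_eq_zero_iff, sub_eq_zero]
    left
    rw [Complex.exp_eq_exp_iff_exists_int]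
    exact ⟨k, by push_cast; ring⟩

lemma norm_binomCoeff_mul_pow {s : ℝ} (hs : 0 ≤ s) (n : ℕ) (v : ℂ) :
    ‖(binomCoeff s n : ℂ) * v ^ n‖ = binomCoeff s n * ‖v‖ ^ n := by
  rw [norm_mul, norm_pow, Complex.norm_real, Real.norm_of_nonneg (binomCoeff_nonneg hs n)]

lemma summable_binomCoeff_mul_pow (s : ℝ) {r : ℝ} (hr : 0 ≤ r) (hr1 : r < 1) :
    Summable fun n => binomCoeff s n * r ^ n :=
  (hasSum_binomCoeff s (by rwa [abs_of_nonneg hr])).summable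

/-- The double series of `1 / |1 - v|^(2s) = (1 - v)^(-s) * conj ((1 - v)^(-s))`. -/
lemma hasSum_prod_binomCoeff {s : ℝ} (hs : 0 ≤ s) {v : ℂ} (hv : ‖v‖ < 1) :
    HasSum (fun p : ℕ × ℕ =>
        ((binomCoeff s p.1 : ℂ) * v ^ p.1) * ((binomCoeff s p.2 : ℂ) * conj v ^ p.2))
      ((1 / ‖1 - v‖ ^ (2 * s) : ℝ) : ℂ) := by
  have hcv : ‖conj v‖ = ‖v‖ := RCLike.norm_conj v
  have h1 := hasSum_binomCoeff_complex s hv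
  have h2 := hasSum_binomCoeff_complex s (hcv.trans_lt hv)
  have hsum := summable_binomCoeff_mul_pow s (norm_nonneg v) hv
  have s1 : Summable fun n => ‖(binomCoeff s n : ℂ) * v ^ n‖ := by
    simp only [norm_binomCoeff_mul_pow hs]
    exact hsum
  have s2 : Summable fun n => ‖(binomCoeff s n : ℂ) * conj v ^ n‖ := by
    simp only [norm_binomCoeff_mul_pow hs, hcv]
    exact hsum
  have hp := summable_mul_of_summable_norm s1 s2
  have h3 := HasSum.mul h1 h2 hp
  have h4 : HasSum (fun n => (binomCoeff s n : ℂ) * conj v ^ n)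
      (conj (1 / (1 - v) ^ (s : ℂ))) := by
    have := Complex.hasSum_conj'.2 h1
    simpa using this
  have h5 : (1 / (1 - v) ^ (s : ℂ)) * (1 / (1 - conj v) ^ (s : ℂ)) =
      ((1 / ‖1 - v‖ ^ (2 * s) : ℝ) : ℂ) := by
    rw [h2.unique h4, Complex.mul_conj, Complex.normSq_eq_norm_sq, norm_div, norm_one,
      Complex.norm_cpow_real, div_pow, one_pow, ← Real.rpow_mul_natCast (norm_nonneg _)]
    norm_num [mul_comm]
  rw [← h5]
  exact h3

/-- Parseval's identity on the circle for `(1 - v)^(-s)`, `v = u e^{iθ}`: integrate the double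
series of `|∑ binomCoeff s n * v^n|²` term by term; only the diagonal survives. -/
lemma hasSum_circle_integral {s : ℝ} (hs : 0 ≤ s) {u : ℂ} (hu : ‖u‖ < 1) :
    HasSum (fun n => 2 * Real.pi * (binomCoeff s n ^ 2 * ‖u‖ ^ (2 * n)))
      (∫ θ in (-Real.pi)..Real.pi, 1 / ‖1 - u * Complex.exp (θ * Complex.I)‖ ^ (2 * s)) := by
  set v : ℝ → ℂ := fun θ => u * Complex.exp (θ * Complex.I) with hv
  have hvn : ∀ θ, ‖v θ‖ = ‖u‖ := fun θ => by simp [hv, Complex.norm_exp_ofReal_mul_I]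
  set t : ℕ × ℕ → ℝ → ℂ := fun p θ =>
    ((binomCoeff s p.1 : ℂ) * v θ ^ p.1) * ((binomCoeff s p.2 : ℂ) * conj (v θ) ^ p.2) with ht
  have hsum1 := summable_binomCoeff_mul_pow s (norm_nonneg u) hu
  have hcv : ∀ θ, ‖conj (v θ)‖ = ‖u‖ := fun θ => by rw [RCLike.norm_conj, hvn]
  have hpt : ∀ θ, HasSum (fun p => t p θ) ((1 / ‖1 - v θ‖ ^ (2 * s) : ℝ) : ℂ) := fun θ =>
    hasSum_prod_binomCoeff hs ((hvn θ).trans_lt hu)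
  have hsum2 : Summable fun p : ℕ × ℕ =>
      (binomCoeff s p.1 * ‖u‖ ^ p.1) * (binomCoeff s p.2 * ‖u‖ ^ p.2) := by
    apply hsum1.mul_of_nonneg hsum1 <;>
    · intro n
      have := binomCoeff_nonneg hs n
      positivity
  have hint := intervalIntegral.hasSum_integral_of_dominated_convergence
    (a := -Real.pi) (b := Real.pi) (μ := volume) (F := t)
    (f := fun θ => ((1 / ‖1 - v θ‖ ^ (2 * s) : ℝ) : ℂ))
    (fun p _ => (binomCoeff s p.1 * ‖u‖ ^ p.1) * (binomCoeff s p.2 * ‖u‖ ^ p.2))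
    (fun p => (by simp only [ht, hv]; fun_prop : Continuous (t p)).aestronglyMeasurable)
    (fun p => ae_of_all _ fun θ _ => by
      refine le_of_eq ?_
      rw [ht, norm_mul, norm_binomCoeff_mul_pow hs, norm_binomCoeff_mul_pow hs, hvn, hcv])
    (ae_of_all _ fun θ _ => hsum2)
    (by simp)
    (ae_of_all _ fun θ _ => hpt θ)
  -- the off-diagonal terms integrate to zero
  have hterm : ∀ p : ℕ × ℕ, ∫ θ in (-Real.pi)..Real.pi, t p θ =
      if p.1 = p.2 then ((2 * Real.pi * (binomCoeff s p.1 ^ 2 * ‖u‖ ^ (2 * p.1)) : ℝ) : ℂ)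
      else 0 := by
    rintro ⟨n, m⟩
    have h : ∀ θ : ℝ, t (n, m) θ = (binomCoeff s n * binomCoeff s m * (u ^ n * conj u ^ m) : ℂ) *
        Complex.exp (((n - m : ℤ) : ℂ) * (θ * Complex.I)) := by
      intro θ
      have he : Complex.exp (((n - m : ℤ) : ℂ) * (θ * Complex.I)) =
          Complex.exp (θ * Complex.I) ^ n * Complex.exp (-(θ * Complex.I)) ^ m := by
        rw [← Complex.exp_nat_mul, ← Complex.exp_nat_mul, ← Complex.exp_add]
        push_cast
        ring_nf
      have hc : conj (Complex.exp (θ * Complex.I)) = Complex.exp (-(θ * Complex.I)) := by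
        rw [← Complex.exp_conj]
        simp
      simp only [ht, hv, he, map_mul, hc, mul_pow]
      ring
    simp only [h, intervalIntegral.integral_const_mul, integral_exp_int_mul_I]
    by_cases hnm : n = m
    · subst hnm
      simp only [sub_self, if_true]
      rw [← mul_pow, Complex.mul_conj, Complex.normSq_eq_norm_sq]
      push_cast
      ring
    · have : (n : ℤ) - m ≠ 0 := by omega
      simp [hnm, this]
  rw [intervalIntegral.integral_ofReal] at hint
  simp only [hterm] at hint
  have hinj : Function.Injective fun n : ℕ => (n, n) := fun a b h => (Prod.mk.inj h).1
  rw [← hinj.hasSum_iff (by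
    rintro ⟨n, m⟩ hx
    exact if_neg fun h : n = m => hx ⟨n, by simp [h]⟩)] at hint
  simp only [Function.comp_def, if_true] at hint
  exact Complex.hasSum_ofReal.1 hint

/-! ### The `L^q` norm of the kernel -/

lemma measurable_adjKernel (z : ℂ) : Measurable (adjKernel z) := by
  unfold adjKernel
  fun_prop

lemma norm_adjKernel (z w : ℂ) : ‖adjKernel z w‖ = ‖w‖ / ‖1 - conj z * w‖ := by
  rw [adjKernel, norm_div, RCLike.norm_conj, ← RCLike.norm_conj (1 - conj w * z)]
  simp [mul_comm]

/-- The integral of `|k_z|^q` over the circle of radius `r`, in the polar parametrization. -/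
lemma lintegral_circle_adjKernel {q : ℝ} (hq : 0 < q) {z : ℂ} (hz : ‖z‖ < 1) {r : ℝ}
    (hr : 0 < r) (hr1 : r < 1) :
    ∫⁻ θ in Ioo (-Real.pi) Real.pi, ENNReal.ofReal r *
        ‖adjKernel z (Complex.polarCoord.symm (r, θ))‖ₑ ^ q =
      ∑' n, ENNReal.ofReal
        (2 * Real.pi * (binomCoeff (q / 2) n ^ 2 * ‖z‖ ^ (2 * n)) * r ^ (2 * n + q + 1)) := by
  have hs : 0 ≤ q / 2 := by positivity
  set u : ℂ := conj z * r with hu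
  have hun : ‖u‖ = ‖z‖ * r := by
    rw [hu, norm_mul, RCLike.norm_conj, Complex.norm_real, Real.norm_of_nonneg hr.le]
  have hu1 : ‖u‖ < 1 := by rw [hun]; nlinarith [norm_nonneg z]
  have hne : ∀ θ : ℝ, 0 < ‖1 - u * Complex.exp (θ * Complex.I)‖ := fun θ => by
    rw [norm_pos_iff, sub_ne_zero]
    intro h
    have := congrArg norm h
    rw [norm_mul, Complex.norm_exp_ofReal_mul_I, norm_one] at this
    linarith
  have hpt : ∀ θ : ℝ, ENNReal.ofReal r * ‖adjKernel z (Complex.polarCoord.symm (r, θ))‖ₑ ^ q =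
      ENNReal.ofReal (r ^ (q + 1) *
        (1 / ‖1 - u * Complex.exp (θ * Complex.I)‖ ^ (2 * (q / 2)))) := by
    intro θ
    have hw : Complex.polarCoord.symm (r, θ) = r * Complex.exp (θ * Complex.I) := by
      rw [Complex.polarCoord_symm_apply, Complex.exp_mul_I]
      push_cast
      rfl
    rw [← ofReal_norm, norm_adjKernel, ENNReal.ofReal_rpow_of_nonneg (by positivity) hq.le,
      ← ENNReal.ofReal_mul hr.le, hw, norm_mul, Complex.norm_exp_ofReal_mul_I, mul_one,
      Complex.norm_real, Real.norm_of_nonneg hr.le, ← mul_assoc, ← hu,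
      Real.div_rpow hr.le (norm_nonneg _), Real.rpow_add_one hr.ne']
    congr 1
    rw [show 2 * (q / 2) = q by ring]
    ring
  have hcont : Continuous fun θ : ℝ => r ^ (q + 1) *
      (1 / ‖1 - u * Complex.exp (θ * Complex.I)‖ ^ (2 * (q / 2))) := by
    refine continuous_const.mul (continuous_const.div ?_ fun θ => ?_)
    · exact (by fun_prop : Continuous fun θ : ℝ => ‖1 - u * Complex.exp (θ * Complex.I)‖).rpow_const
        fun θ => Or.inl (hne θ).ne'
    · exact (Real.rpow_pos_of_pos (hne θ) _).ne'
  have hpi : -Real.pi ≤ Real.pi := by linarith [Real.pi_pos]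
  have hsum := (hasSum_circle_integral hs hu1).mul_left (r ^ (q + 1))
  simp only [hpt]
  rw [setLIntegral_congr Ioo_ae_eq_Ioc, ← ofReal_integral_eq_lintegral_ofReal
    ((intervalIntegrable_iff_integrableOn_Ioc_of_le hpi).1 (hcont.intervalIntegrable _ _))
    (ae_of_all _ fun θ => by positivity), ← intervalIntegral.integral_of_le hpi,
    intervalIntegral.integral_const_mul, ← hsum.tsum_eq,
    ENNReal.ofReal_tsum_of_nonneg (fun n => by positivity) hsum.summable]
  congr 1
  funext n
  congr 1
  rw [hun, mul_pow, show (2 * n + q + 1 : ℝ) = (q + 1) + (2 * n : ℕ) by push_cast; ring,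
    Real.rpow_add_natCast hr.ne']
  ring

lemma lintegral_Ioo_const_mul_rpow {C a : ℝ} (hC : 0 ≤ C) (ha : 0 ≤ a) :
    ∫⁻ r in Ioo (0 : ℝ) 1, ENNReal.ofReal (C * r ^ a) = ENNReal.ofReal (C / (a + 1)) := by
  have hi : IntervalIntegrable (fun r : ℝ => C * r ^ a) volume 0 1 :=
    (intervalIntegral.intervalIntegrable_rpow (Or.inl ha)).const_mul C
  rw [setLIntegral_congr Ioo_ae_eq_Ioc, ← ofReal_integral_eq_lintegral_ofReal
    ((intervalIntegrable_iff_integrableOn_Ioc_of_le zero_le_one).1 hi)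
    ((ae_restrict_mem measurableSet_Ioc).mono fun r hr => by
      have := hr.1
      positivity), ← intervalIntegral.integral_of_le zero_le_one,
    intervalIntegral.integral_const_mul, integral_rpow (Or.inl (by linarith))]
  congr 1
  rw [Real.one_rpow, Real.zero_rpow (by positivity)]
  ring

lemma lintegral_enorm_adjKernel_rpow {q : ℝ} (hq : 0 < q) (hq2 : q < 2) {z : ℂ} (hz : ‖z‖ < 1) :
    ∫⁻ w, ‖adjKernel z w‖ₑ ^ q ∂diskArea =
      ENNReal.ofReal (∑' n, kernelCoeff (q / 2) n * (‖z‖ ^ 2) ^ n) := by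
  have hs : 0 ≤ q / 2 := by positivity
  set F : ℂ → ℝ≥0∞ := (Metric.ball (0 : ℂ) 1).indicator fun w => ‖adjKernel z w‖ₑ ^ q with hF
  have hFm : Measurable F :=
    ((measurable_adjKernel z).enorm.pow_const q).indicator Metric.isOpen_ball.measurableSet
  have hpm : Measurable fun p : ℝ × ℝ => ENNReal.ofReal p.1 * F (Complex.polarCoord.symm p) := by
    refine (ENNReal.measurable_ofReal.comp measurable_fst).mul (hFm.comp ?_)
    have : (fun p : ℝ × ℝ => Complex.polarCoord.symm p) =
        fun p => (p.1 * (Real.cos p.2 + Real.sin p.2 * Complex.I) : ℂ) :=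
      funext Complex.polarCoord_symm_apply
    change Measurable fun p : ℝ × ℝ => Complex.polarCoord.symm p
    rw [this]
    fun_prop
  have hpolar : ∫⁻ w, F w = ∫⁻ r in Ioi (0 : ℝ), ∫⁻ θ in Ioo (-Real.pi) Real.pi,
      ENNReal.ofReal r * F (Complex.polarCoord.symm (r, θ)) := by
    rw [← Complex.lintegral_comp_polarCoord_symm, polarCoord_target, Measure.volume_eq_prod,
      ← Measure.prod_restrict]
    simp only [smul_eq_mul]
    rw [lintegral_prod _ hpm.aemeasurable]
  have hcircle : ∀ r ∈ Ioi (0 : ℝ), ∫⁻ θ in Ioo (-Real.pi) Real.pi,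
      ENNReal.ofReal r * F (Complex.polarCoord.symm (r, θ)) =
      (Iio (1 : ℝ)).indicator (fun r => ∑' n, ENNReal.ofReal
        (2 * Real.pi * (binomCoeff (q / 2) n ^ 2 * ‖z‖ ^ (2 * n)) * r ^ (2 * n + q + 1))) r := by
    intro r hr
    have hr0 : 0 < r := hr
    have hnorm : ∀ θ, ‖Complex.polarCoord.symm (r, θ)‖ = r := fun θ => by
      rw [Complex.norm_polarCoord_symm, abs_of_pos hr0]
    by_cases hr1 : r < 1
    · rw [indicator_of_mem (by exact hr1), ← lintegral_circle_adjKernel hq hz hr0 hr1]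
      congr 1
      funext θ
      rw [hF, indicator_of_mem (by rw [mem_ball_zero_iff, hnorm]; exact hr1)]
    · rw [indicator_of_notMem (by exact hr1)]
      have : ∀ θ, F (Complex.polarCoord.symm (r, θ)) = 0 := fun θ =>
        indicator_of_notMem (by rw [mem_ball_zero_iff, hnorm]; exact hr1) _
      simp only [this, mul_zero, lintegral_zero]
  rw [diskArea, lintegral_smul_measure, ← lintegral_indicator Metric.isOpen_ball.measurableSet,
    ← hF, hpolar, setLIntegral_congr_fun measurableSet_Ioi hcircle,
    lintegral_indicator measurableSet_Iio, Measure.restrict_restrict measurableSet_Iio,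
    inter_comm, Ioi_inter_Iio, lintegral_tsum fun n => by fun_prop, smul_eq_mul,
    ← ENNReal.tsum_mul_left,
    ENNReal.ofReal_tsum_of_nonneg
      (fun n => mul_nonneg (kernelCoeff_nonneg hs n) (by positivity))
      (summable_kernelCoeff_mul_pow hs (by linarith) (by positivity)
        (pow_le_one₀ (norm_nonneg z) hz.le))]
  congr 1
  funext n
  rw [lintegral_Ioo_const_mul_rpow (by positivity) (by positivity),
    ← ENNReal.ofReal_mul (by positivity)]
  congr 1
  rw [kernelCoeff, ← pow_mul]
  have := Real.pi_pos
  have h1 : (2 * n + q + 1 + 1 : ℝ) = 2 * (n + 1 + q / 2) := by ring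
  rw [h1]
  field_simp

/-! ### The operator on `L^p` -/

instance isFiniteMeasure_diskArea : IsFiniteMeasure diskArea := by
  unfold diskArea
  have : IsFiniteMeasure (volume.restrict (Metric.ball (0 : ℂ) 1)) :=
    ⟨by rw [Measure.restrict_apply_univ]; exact measure_ball_lt_top⟩
  exact Measure.smul_finite _ ENNReal.ofReal_ne_top

lemma absolutelyContinuous_diskArea :
    volume.restrict (Metric.ball (0 : ℂ) 1) ≪ diskArea :=
  Measure.absolutelyContinuous_smul (by simp [Real.pi_pos])

lemma diskArea_absolutelyContinuous :
    diskArea ≪ volume.restrict (Metric.ball (0 : ℂ) 1) :=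
  Measure.smul_absolutelyContinuous

lemma ae_diskArea_mem_ball : ∀ᵐ w ∂diskArea, w ∈ Metric.ball (0 : ℂ) 1 :=
  diskArea_absolutelyContinuous.ae_le (ae_restrict_mem Metric.isOpen_ball.measurableSet)

lemma norm_adjKernel_le {z w : ℂ} {R : ℝ} (hz : ‖z‖ ≤ R) (hR : R < 1) (hw : ‖w‖ < 1) :
    ‖adjKernel z w‖ ≤ 1 / (1 - R) := by
  rw [norm_adjKernel]
  have h : 1 - R ≤ ‖1 - conj z * w‖ := by
    have h1 := norm_sub_norm_le (1 : ℂ) (conj z * w)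
    rw [norm_one, norm_mul, RCLike.norm_conj] at h1
    nlinarith [norm_nonneg z, norm_nonneg w]
  exact div_le_div₀ zero_le_one hw.le (by linarith) h

lemma integrable_adjKernel_mul {f : ℂ → ℂ} (hf : Integrable f diskArea) {z : ℂ} (hz : ‖z‖ < 1) :
    Integrable (fun w => adjKernel z w * f w) diskArea :=
  hf.bdd_mul (measurable_adjKernel z).aestronglyMeasurable
    (ae_diskArea_mem_ball.mono fun _ hw =>
      norm_adjKernel_le le_rfl hz (mem_ball_zero_iff.1 hw))

lemma continuousOn_adjJ {f : ℂ → ℂ} (hf : Integrable f diskArea) :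
    ContinuousOn (adjJ f) (Metric.ball 0 1) := by
  intro z₀ hz₀
  obtain ⟨R, hR0, hR⟩ := exists_between (mem_ball_zero_iff.1 hz₀)
  have hnhds : ∀ᶠ z in 𝓝 z₀, ‖z‖ < R := continuous_norm.continuousAt.eventually_lt_const hR0
  refine ContinuousAt.continuousWithinAt ?_
  refine continuousAt_of_dominated (F := fun z w => adjKernel z w * f w)
    (bound := fun w => 1 / (1 - R) * ‖f w‖)
    (hnhds.mono fun z hz => (integrable_adjKernel_mul hf (hz.trans hR)).1)
    (hnhds.mono fun z hz => ae_diskArea_mem_ball.mono fun w hw => ?_)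
    (hf.norm.const_mul _)
    (ae_diskArea_mem_ball.mono fun w hw => ?_)
  · rw [norm_mul]
    exact mul_le_mul_of_nonneg_right (norm_adjKernel_le hz.le hR (mem_ball_zero_iff.1 hw))
      (norm_nonneg _)
  · have hne : 1 - conj w * z₀ ≠ 0 := by
      rw [sub_ne_zero]
      intro h
      have h1 := congrArg norm h
      rw [norm_one, norm_mul, RCLike.norm_conj] at h1
      have := mem_ball_zero_iff.1 hw
      have := mem_ball_zero_iff.1 hz₀
      nlinarith [norm_nonneg w, norm_nonneg z₀]
    unfold adjKernel
    have hc : ContinuousAt (fun z => 1 - conj w * z) z₀ := by fun_prop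
    exact (continuousAt_const.div hc hne).mul continuousAt_const

lemma aestronglyMeasurable_adjJ {f : ℂ → ℂ} (hf : Integrable f diskArea) :
    AEStronglyMeasurable (adjJ f) diskArea :=
  ((continuousOn_adjJ hf).aestronglyMeasurable Metric.isOpen_ball.measurableSet).mono_ac
    diskArea_absolutelyContinuous

/-- As `adjJ f` is continuous on the disk, its essential supremum bounds every value. -/
lemma enorm_adjJ_le_eLpNorm_top {f : ℂ → ℂ} (hf : Integrable f diskArea) {z : ℂ} (hz : ‖z‖ < 1) :
    ‖adjJ f z‖ₑ ≤ eLpNorm (adjJ f) ∞ diskArea := by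
  by_contra! hlt
  set M := eLpNorm (adjJ f) ∞ diskArea with hM
  have hae : ∀ᵐ w ∂volume.restrict (Metric.ball (0 : ℂ) 1), ‖adjJ f w‖ₑ ≤ M := by
    refine absolutelyContinuous_diskArea.ae_le ?_
    rw [hM, eLpNorm_exponent_top]
    exact enorm_ae_le_eLpNormEssSup _ _
  have hopen : IsOpen (Metric.ball (0 : ℂ) 1 ∩ {w | M < ‖adjJ f w‖ₑ}) :=
    (continuousOn_adjJ hf).enorm.isOpen_inter_preimage Metric.isOpen_ball isOpen_Ioi
  have hzero : volume (Metric.ball (0 : ℂ) 1 ∩ {w | M < ‖adjJ f w‖ₑ}) = 0 := by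
    rw [ae_iff, Measure.restrict_apply₀' Metric.isOpen_ball.measurableSet.nullMeasurableSet] at hae
    simpa only [not_le, inter_comm] using hae
  have hempty := hopen.measure_eq_zero_iff volume |>.1 hzero
  exact Set.notMem_empty z (hempty ▸ ⟨mem_ball_zero_iff.2 hz, hlt⟩)

lemma eLpNorm_adjKernel {q : ℝ} (hq : 1 ≤ q) (hq2 : q < 2) {z : ℂ} (hz : ‖z‖ < 1) :
    eLpNorm (adjKernel z) (ENNReal.ofReal q) diskArea =
      ENNReal.ofReal ((∑' n, kernelCoeff (q / 2) n * (‖z‖ ^ 2) ^ n) ^ (1 / q)) := by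
  have hq0 : 0 < q := by linarith
  rw [eLpNorm_eq_lintegral_rpow_enorm_toReal (by simpa using hq0) ENNReal.ofReal_ne_top,
    ENNReal.toReal_ofReal hq0.le, lintegral_enorm_adjKernel_rpow hq0 hq2 hz,
    ENNReal.ofReal_rpow_of_nonneg _ (by positivity)]
  exact tsum_nonneg fun n => mul_nonneg (kernelCoeff_nonneg (by positivity) n) (by positivity)

lemma eLpNorm_adjKernel_le {q : ℝ} (hq : 1 ≤ q) (hq2 : q < 2) {z : ℂ} (hz : ‖z‖ < 1) :
    eLpNorm (adjKernel z) (ENNReal.ofReal q) diskArea ≤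
      ENNReal.ofReal (constA q ^ (1 / q)) := by
  have hs : 0 ≤ q / 2 := by positivity
  have hx1 : ‖z‖ ^ 2 ≤ 1 := pow_le_one₀ (norm_nonneg z) hz.le
  rw [eLpNorm_adjKernel hq hq2 hz, constA_eq_tsum_kernelCoeff (by linarith)]
  refine ENNReal.ofReal_le_ofReal (Real.rpow_le_rpow ?_ ?_ (by positivity))
  · exact tsum_nonneg fun n => mul_nonneg (kernelCoeff_nonneg hs n) (by positivity)
  · exact (summable_kernelCoeff_mul_pow hs (by linarith) (by positivity) hx1).tsum_le_tsum
      (fun n => mul_le_of_le_one_right (kernelCoeff_nonneg hs n) (pow_le_one₀ (by positivity) hx1))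
      (summable_kernelCoeff hs (by linarith))

section Holder

variable {q : ℝ} {p : ℝ≥0∞} [hpq : ENNReal.HolderConjugate (ENNReal.ofReal q) p]

lemma enorm_adjJ_le (hq : 1 ≤ q) (hq2 : q < 2) {f : ℂ → ℂ}
    (hf : AEStronglyMeasurable f diskArea) {z : ℂ} (hz : ‖z‖ < 1) :
    ‖adjJ f z‖ₑ ≤ ENNReal.ofReal (constA q ^ (1 / q)) * eLpNorm f p diskArea :=
  calc ‖adjJ f z‖ₑ ≤ eLpNorm (adjKernel z • f) 1 diskArea := by
        rw [eLpNorm_one_eq_lintegral_enorm]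
        exact enorm_integral_le_lintegral_enorm _
    _ ≤ eLpNorm (adjKernel z) (ENNReal.ofReal q) diskArea * eLpNorm f p diskArea :=
        eLpNorm_smul_le_mul_eLpNorm hf (measurable_adjKernel z).aestronglyMeasurable
    _ ≤ _ := by gcongr; exact eLpNorm_adjKernel_le hq hq2 hz

lemma eLpNorm_adjJ_top_le (hq : 1 ≤ q) (hq2 : q < 2) {f : ℂ → ℂ}
    (hf : AEStronglyMeasurable f diskArea) :
    eLpNorm (adjJ f) ∞ diskArea ≤
      ENNReal.ofReal (constA q ^ (1 / q)) * eLpNorm f p diskArea := by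
  rw [eLpNorm_exponent_top]
  exact eLpNormEssSup_le_of_ae_enorm_bound
    (ae_diskArea_mem_ball.mono fun z hz => enorm_adjJ_le hq hq2 hf (mem_ball_zero_iff.1 hz))

lemma memLp_adjJ_top (hq : 1 ≤ q) (hq2 : q < 2) {f : ℂ → ℂ} (hf : MemLp f p diskArea)
    (hf1 : Integrable f diskArea) : MemLp (adjJ f) ∞ diskArea :=
  ⟨aestronglyMeasurable_adjJ hf1, (eLpNorm_adjJ_top_le hq hq2 hf.1).trans_lt
    (ENNReal.mul_lt_top ENNReal.ofReal_lt_top hf.2)⟩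

/-- It suffices to attain the value `‖k_z‖_q` at each `z` in the disk: these values tend to
`constA q ^ (1 / q)` as `|z| → 1`. -/
lemma adjJNorm_eq (hq : 1 ≤ q) (hq2 : q < 2) (hp : 1 ≤ p)
    (hext : ∀ z : ℂ, ‖z‖ < 1 → ∃ f, MemLp f p diskArea ∧ eLpNorm f p diskArea = 1 ∧
      ‖adjJ f z‖ₑ = ENNReal.ofReal ((∑' n, kernelCoeff (q / 2) n * (‖z‖ ^ 2) ^ n) ^ (1 / q))) :
    adjJNorm p = ENNReal.ofReal (constA q ^ (1 / q)) := by
  apply le_antisymm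
  · refine sSup_le ?_
    rintro _ ⟨f, hf, hf1, rfl⟩
    simpa [hf1] using eLpNorm_adjJ_top_le (p := p) hq hq2 hf.1
  · have hs : 0 ≤ q / 2 := by positivity
    have hlim : Tendsto (fun x : ℝ => ENNReal.ofReal
        ((∑' n, kernelCoeff (q / 2) n * x ^ n) ^ (1 / q))) (𝓝[<] 1)
        (𝓝 (ENNReal.ofReal (constA q ^ (1 / q)))) := by
      rw [constA_eq_tsum_kernelCoeff (by linarith)]
      exact ENNReal.tendsto_ofReal
        ((tendsto_tsum_kernelCoeff hs (by linarith)).rpow_const (Or.inr (by positivity)))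
    refine le_of_tendsto hlim ?_
    filter_upwards [Ioo_mem_nhdsLT (zero_lt_one' ℝ)] with x hx
    have hn : ‖((√x : ℝ) : ℂ)‖ = √x := by
      rw [Complex.norm_real, Real.norm_of_nonneg (Real.sqrt_nonneg x)]
    have hz : ‖((√x : ℝ) : ℂ)‖ < 1 := by
      rw [hn, Real.sqrt_lt' one_pos, one_pow]
      exact hx.2
    obtain ⟨f, hf, hf1, hfz⟩ := hext _ hz
    rw [hn, Real.sq_sqrt hx.1.le] at hfz
    rw [← hfz]
    exact (enorm_adjJ_le_eLpNorm_top (hf.integrable hp) hz).trans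
      (le_sSup ⟨f, hf, hf1, rfl⟩)

end Holder

/-! ### Extremal functions -/

lemma integral_norm_adjKernel_rpow {q : ℝ} (hq : 0 < q) (hq2 : q < 2) {z : ℂ} (hz : ‖z‖ < 1) :
    ∫ w, ‖adjKernel z w‖ ^ q ∂diskArea = ∑' n, kernelCoeff (q / 2) n * (‖z‖ ^ 2) ^ n := by
  have h := lintegral_enorm_adjKernel_rpow hq hq2 hz
  rw [integral_eq_lintegral_of_nonneg_ae (ae_of_all _ fun w => by positivity)
    ((measurable_adjKernel z).norm.pow_const q).aestronglyMeasurable]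
  have h2 : ∀ w, ENNReal.ofReal (‖adjKernel z w‖ ^ q) = ‖adjKernel z w‖ₑ ^ q := fun w => by
    rw [← ENNReal.ofReal_rpow_of_nonneg (norm_nonneg _) hq.le, ofReal_norm]
  simp only [h2, h]
  exact ENNReal.toReal_ofReal
    (tsum_nonneg fun n => mul_nonneg (kernelCoeff_nonneg (by positivity) n) (by positivity))

lemma tsum_kernelCoeff_mul_pow_pos {s : ℝ} (hs : 0 ≤ s) (hs1 : s < 1) {x : ℝ} (hx : 0 ≤ x)
    (hx1 : x ≤ 1) : 0 < ∑' n, kernelCoeff s n * x ^ n :=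
  (summable_kernelCoeff_mul_pow hs hs1 hx hx1).tsum_pos
    (fun n => mul_nonneg (kernelCoeff_nonneg hs n) (by positivity)) 0
    (by simp only [kernelCoeff, binomCoeff_zero]; positivity)

/-- Equality in Hölder's inequality for `p = ∞`, by the conjugate phase of `k_z`. -/
lemma exists_extremal_top {z : ℂ} (hz : ‖z‖ < 1) :
    ∃ f, MemLp f ∞ diskArea ∧ eLpNorm f ∞ diskArea = 1 ∧
      ‖adjJ f z‖ₑ =
        ENNReal.ofReal ((∑' n, kernelCoeff (1 / 2) n * (‖z‖ ^ 2) ^ n) ^ (1 / (1 : ℝ))) := by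
  classical
  -- the value `1` at the zeros of the kernel makes `|f| = 1` hold everywhere
  set f : ℂ → ℂ := fun w =>
    if adjKernel z w = 0 then 1 else conj (adjKernel z w) / (‖adjKernel z w‖ : ℂ) with hf
  have hfm : Measurable f := by
    have hk := measurable_adjKernel z
    exact Measurable.ite (hk (measurableSet_singleton 0)) measurable_const
      ((Complex.continuous_conj.measurable.comp hk).div
        (Complex.measurable_ofReal.comp hk.norm))
  have hfn : ∀ w, ‖f w‖ = 1 := by
    intro w
    by_cases h : adjKernel z w = 0
    · simp [hf, h]
    · simp [hf, h]
  have hkf : ∀ w, adjKernel z w * f w = ((‖adjKernel z w‖ ^ (1 : ℝ) : ℝ) : ℂ) := by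
    intro w
    by_cases h : adjKernel z w = 0
    · simp [h]
    · simp only [hf, h, if_false, Real.rpow_one]
      have : (‖adjKernel z w‖ : ℂ) ≠ 0 := by simpa using h
      rw [mul_div_assoc', Complex.mul_conj, Complex.normSq_eq_norm_sq, div_eq_iff this]
      push_cast
      ring
  have hne : diskArea ≠ 0 := by
    intro h
    have h1 := absolutelyContinuous_diskArea
    rw [h, Measure.absolutelyContinuous_zero_iff, Measure.restrict_eq_zero] at h1
    exact (Metric.measure_ball_pos volume (0 : ℂ) one_pos).ne' h1
  have hnorm : eLpNorm f ∞ diskArea = 1 := by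
    rw [eLpNorm_congr_norm_ae (g := fun _ => (1 : ℂ)) (ae_of_all _ fun w => by simp [hfn]),
      eLpNorm_exponent_top, eLpNormEssSup_const _ hne]
    simp
  refine ⟨f, ⟨hfm.aestronglyMeasurable, by simp [hnorm]⟩, hnorm, ?_⟩
  have hv := integral_norm_adjKernel_rpow one_pos one_lt_two hz
  have hpos := tsum_kernelCoeff_mul_pow_pos (s := 1 / 2) (by norm_num) (by norm_num)
    (sq_nonneg ‖z‖) (pow_le_one₀ (norm_nonneg z) hz.le)
  simp only [adjJ, hkf]
  rw [integral_complex_ofReal, hv, ← ofReal_norm, Complex.norm_real, Real.norm_of_nonneg hpos.le]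
  simp

/-- Equality in Hölder's inequality for `p < ∞`, by a multiple of `conj k_z * |k_z|^(q - 2)`. -/
lemma exists_extremal {p q : ℝ} (hpq : q.HolderConjugate p) (hq2 : q < 2) {z : ℂ} (hz : ‖z‖ < 1) :
    ∃ f, MemLp f (ENNReal.ofReal p) diskArea ∧ eLpNorm f (ENNReal.ofReal p) diskArea = 1 ∧
      ‖adjJ f z‖ₑ =
        ENNReal.ofReal ((∑' n, kernelCoeff (q / 2) n * (‖z‖ ^ 2) ^ n) ^ (1 / q)) := by
  have hq0 : 0 < q := hpq.pos
  have hp0 : 0 < p := hpq.symm.pos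
  set N := ∑' n, kernelCoeff (q / 2) n * (‖z‖ ^ 2) ^ n with hN
  have hpos : 0 < N := tsum_kernelCoeff_mul_pow_pos (by positivity) (by linarith)
    (sq_nonneg ‖z‖) (pow_le_one₀ (norm_nonneg z) hz.le)
  -- `|f|^p = |k_z|^q / N` because `(q - 1) * p = q`
  set f : ℂ → ℂ := fun w =>
    ((N ^ (-1 / p) * ‖adjKernel z w‖ ^ (q - 2) : ℝ) : ℂ) * conj (adjKernel z w) with hf
  have hk := measurable_adjKernel z
  have hfm : Measurable f :=
    (Complex.measurable_ofReal.comp (measurable_const.mul (hk.norm.pow_const _))).mul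
      (Complex.continuous_conj.measurable.comp hk)
  have hfn : ∀ w, ‖f w‖ₑ ^ p = ENNReal.ofReal N⁻¹ * ‖adjKernel z w‖ₑ ^ q := by
    intro w
    rw [← ofReal_norm, ← ofReal_norm, ENNReal.ofReal_rpow_of_nonneg (norm_nonneg _) hp0.le,
      ENNReal.ofReal_rpow_of_nonneg (norm_nonneg _) hq0.le, ← ENNReal.ofReal_mul (by positivity)]
    congr 1
    rw [hf, norm_mul, Complex.norm_real, RCLike.norm_conj, Real.norm_of_nonneg (by positivity)]
    rcases (norm_nonneg (adjKernel z w)).eq_or_lt with h | h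
    · rw [← h, mul_zero, Real.zero_rpow hp0.ne', Real.zero_rpow hq0.ne', mul_zero]
    · rw [mul_assoc, ← Real.rpow_add_one h.ne', Real.mul_rpow (by positivity) (by positivity),
        ← Real.rpow_mul hpos.le, ← Real.rpow_mul h.le, div_mul_cancel₀ _ hp0.ne',
        Real.rpow_neg_one]
      congr 2
      have := hpq.symm.sub_one_mul_conj
      have := hpq.sub_one_mul_conj
      linarith
  have hnorm : eLpNorm f (ENNReal.ofReal p) diskArea = 1 := by
    rw [eLpNorm_eq_lintegral_rpow_enorm_toReal (by simpa using hp0) ENNReal.ofReal_ne_top,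
      ENNReal.toReal_ofReal hp0.le]
    simp only [hfn]
    rw [lintegral_const_mul' _ _ ENNReal.ofReal_ne_top, lintegral_enorm_adjKernel_rpow hq0 hq2 hz,
      ← hN, ← ENNReal.ofReal_mul (by positivity), inv_mul_cancel₀ hpos.ne']
    simp
  refine ⟨f, ⟨hfm.aestronglyMeasurable, by simp [hnorm]⟩, hnorm, ?_⟩
  have hkf : ∀ w, adjKernel z w * f w =
      ((N ^ (-1 / p) * ‖adjKernel z w‖ ^ q : ℝ) : ℂ) := by
    intro w
    rw [hf, mul_left_comm, Complex.mul_conj, Complex.normSq_eq_norm_sq, ← Complex.ofReal_mul]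
    congr 1
    rcases (norm_nonneg (adjKernel z w)).eq_or_lt with h | h
    · rw [← h, Real.zero_rpow hq0.ne']
      simp
    · rw [mul_assoc, ← Real.rpow_add_natCast h.ne']
      norm_num
  have hexp : N ^ (-1 / p) * N = N ^ (1 / q) := by
    rw [← Real.rpow_add_one hpos.ne']
    congr 1
    have := hpq.inv_add_inv_eq_one
    rw [one_div, neg_div, one_div]
    linarith
  simp only [adjJ, hkf]
  rw [integral_complex_ofReal, integral_const_mul, integral_norm_adjKernel_rpow hq0 hq2 hz, ← hN,
    hexp, ← ofReal_norm, Complex.norm_real, Real.norm_of_nonneg (by positivity)]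

instance holderConjugate_ofReal_one_top :
    ENNReal.HolderConjugate (ENNReal.ofReal 1) ∞ := by
  rw [ENNReal.ofReal_one]
  infer_instance

lemma adjJNorm_top_eq_constA : adjJNorm ∞ = ENNReal.ofReal (constA 1) := by
  have h := adjJNorm_eq (q := 1) (p := ∞) le_rfl one_lt_two le_top fun z hz =>
    exists_extremal_top hz
  simpa using h

lemma holderConjugate_div_sub_one {p : ℝ} (hp : 1 < p) : (p / (p - 1)).HolderConjugate p :=
  (Real.HolderConjugate.conjExponent hp).symm

lemma div_sub_one_lt_two {p : ℝ} (hp : 2 < p) : p / (p - 1) < 2 := by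
  rw [div_lt_iff₀ (by linarith)]
  linarith

lemma adjJNorm_ofReal {p : ℝ} (hp : 2 < p) :
    adjJNorm (ENNReal.ofReal p) = ENNReal.ofReal (constA (p / (p - 1)) ^ (1 - 1 / p)) := by
  have hpq := holderConjugate_div_sub_one (p := p) (by linarith)
  have := hpq.ennrealOfReal
  have h := adjJNorm_eq (p := ENNReal.ofReal p) hpq.lt.le (div_sub_one_lt_two hp)
    (by rw [ENNReal.one_le_ofReal]; linarith)
    fun z hz => exists_extremal hpq (div_sub_one_lt_two hp) hz
  rw [h]
  congr 2
  have := hpq.inv_add_inv_eq_one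
  rw [one_div, one_div]
  linarith

lemma memLp_adjJ_top_of_two_lt {p : ℝ≥0∞} (hp : 2 < p) {f : ℂ → ℂ} (hf : MemLp f p diskArea) :
    MemLp (adjJ f) ∞ diskArea := by
  have hf1 : Integrable f diskArea := hf.integrable (ENNReal.one_lt_two.trans hp).le
  induction p with
  | top => exact memLp_adjJ_top (q := 1) le_rfl one_lt_two hf hf1
  | coe p =>
    have hp' : 2 < (p : ℝ) := by exact_mod_cast hp
    have hpq := holderConjugate_div_sub_one (p := p) (by linarith)
    have := hpq.ennrealOfReal
    rw [ENNReal.ofReal_coe_nnreal] at this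
    exact memLp_adjJ_top hpq.lt.le (div_sub_one_lt_two hp') hf hf1

/-! ### The constant for `p = ∞` and Catalan's constant -/

lemma binomCoeff_half_sq_mul_wallis (n : ℕ) :
    binomCoeff (1 / 2) n ^ 2 * (2 * n + 1) * Real.Wallis.W n = 1 := by
  induction n with
  | zero => simp [binomCoeff_zero, Real.Wallis.W]
  | succ n ih =>
    rw [Real.Wallis.W_succ, binomCoeff_succ]
    refine Eq.trans ?_ ih
    push_cast
    field_simp
    ring

lemma tendsto_binomCoeff_half_sq :
    Tendsto (fun n : ℕ => binomCoeff (1 / 2) n ^ 2 * (2 * n + 1)) atTop (𝓝 (2 / Real.pi)) := by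
  have h := Real.Wallis.tendsto_W_nhds_pi_div_two.inv₀ (by positivity)
  rw [inv_div] at h
  exact h.congr fun n => (eq_inv_of_mul_eq_one_left
    (binomCoeff_half_sq_mul_wallis n)).symm

lemma integral_sin_pow_even_half (n : ℕ) :
    ∫ θ in (0 : ℝ)..(Real.pi / 2), Real.sin θ ^ (2 * n) =
      Real.pi / 2 * binomCoeff (1 / 2) n := by
  induction n with
  | zero => simp [binomCoeff_zero]
  | succ n ih =>
    rw [mul_add, mul_one, integral_sin_pow, ih, binomCoeff_succ]
    simp
    field_simp
    ring

lemma hasSum_arcsin {x : ℝ} (hx0 : 0 ≤ x) (hx1 : x < 1) :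
    HasSum (fun n : ℕ => binomCoeff (1 / 2) n * x ^ (2 * n + 1) / (2 * n + 1))
      (Real.arcsin x) := by
  have hmem : ∀ t ∈ uIcc 0 x, 0 ≤ t ∧ t ≤ x := fun t ht => by rwa [uIcc_of_le hx0] at ht
  have hmem' : ∀ t ∈ uIoc 0 x, 0 ≤ t ∧ t ≤ x := fun t ht => hmem t (uIoc_subset_uIcc ht)
  have hsq : ∀ t, 0 ≤ t → t ≤ x → t ^ 2 < 1 := fun t h0 h1 => by nlinarith
  have hint := intervalIntegral.hasSum_integral_of_dominated_convergence
    (a := 0) (b := x) (μ := volume)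
    (F := fun n t => binomCoeff (1 / 2) n * t ^ (2 * n))
    (f := fun t => 1 / √(1 - t ^ 2))
    (fun n _ => binomCoeff (1 / 2) n * (x ^ 2) ^ n)
    (fun n => (by fun_prop : Continuous fun t : ℝ =>
      binomCoeff (1 / 2) n * t ^ (2 * n)).aestronglyMeasurable)
    (fun n => ae_of_all _ fun t ht => by
      have hc := binomCoeff_nonneg (s := 1 / 2) (by norm_num) n
      have h0 := (hmem' t ht).1
      rw [Real.norm_of_nonneg (by positivity), ← pow_mul]
      gcongr
      exact (hmem' t ht).2)
    (ae_of_all _ fun t ht => summable_binomCoeff_mul_pow _ (sq_nonneg x) (hsq x hx0 le_rfl))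
    (by simp)
    (ae_of_all _ fun t ht => by
      have h1 := hsq t (hmem' t ht).1 (hmem' t ht).2
      have h := hasSum_binomCoeff (1 / 2) (x := t ^ 2) (by rwa [abs_of_nonneg (sq_nonneg t)])
      rw [← Real.sqrt_eq_rpow] at h
      simpa only [← pow_mul] using h)
  have hFTC : ∫ t in (0 : ℝ)..x, 1 / √(1 - t ^ 2) = Real.arcsin x := by
    rw [intervalIntegral.integral_eq_sub_of_hasDerivAt (f := Real.arcsin)
      (f' := fun t => 1 / √(1 - t ^ 2))]
    · simp
    · intro t ht
      exact Real.hasDerivAt_arcsin (by linarith [hmem t ht]) (by linarith [hmem t ht])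
    · refine ContinuousOn.intervalIntegrable ?_
      refine continuousOn_const.div (by fun_prop) fun t ht => ?_
      have := hsq t (hmem t ht).1 (hmem t ht).2
      exact (Real.sqrt_pos.2 (by linarith)).ne'
  rw [hFTC] at hint
  refine hint.congr_fun fun n => ?_
  rw [intervalIntegral.integral_const_mul, integral_pow]
  push_cast
  ring

lemma hasSum_div_sin {θ : ℝ} (hθ : θ ∈ Ioo 0 (Real.pi / 2)) :
    HasSum (fun n : ℕ => binomCoeff (1 / 2) n / (2 * n + 1) * Real.sin θ ^ (2 * n))
      (θ / Real.sin θ) := by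
  have hs : 0 < Real.sin θ := Real.sin_pos_of_pos_of_lt_pi hθ.1 (by linarith [hθ.2, Real.pi_pos])
  have hs1 : Real.sin θ < 1 := by
    rw [← Real.sin_pi_div_two]
    exact Real.sin_lt_sin_of_lt_of_le_pi_div_two (by linarith [hθ.1, Real.pi_pos]) le_rfl hθ.2
  have h := (hasSum_arcsin hs.le hs1).div_const (Real.sin θ)
  rw [Real.arcsin_sin (by linarith [hθ.1, Real.pi_pos]) hθ.2.le] at h
  convert! h using 2 with n
  field_simp
  ring

lemma hasSum_arctan_div {t : ℝ} (ht : t ∈ Ioo (0 : ℝ) 1) :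
    HasSum (fun n : ℕ => (-1 : ℝ) ^ n / (2 * n + 1) * t ^ (2 * n)) (Real.arctan t / t) := by
  have ht0 := ht.1.ne'
  have h := (Real.hasSum_arctan (x := t) (by
    rw [Real.norm_of_nonneg ht.1.le]; exact ht.2)).div_const t
  convert! h using 2 with n
  push_cast
  field_simp
  ring

lemma summable_one_div_two_mul_add_one_sq :
    Summable fun n : ℕ => 1 / (2 * (n : ℝ) + 1) ^ 2 := by
  have h := (Real.summable_one_div_nat_pow.2 one_lt_two).comp_injective
    (i := fun n : ℕ => 2 * n + 1) (fun a b h => by simpa using h)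
  simpa [Function.comp_def] using h

lemma integral_Ioo_pow (n : ℕ) : ∫ t in Ioo (0 : ℝ) 1, t ^ (2 * n) = 1 / (2 * n + 1) := by
  rw [← integral_Ioc_eq_integral_Ioo, ← intervalIntegral.integral_of_le zero_le_one, integral_pow]
  simp

lemma integral_arctan_div : ∫ t in Ioo (0 : ℝ) 1, Real.arctan t / t = catalanConst := by
  have hint : ∀ n : ℕ, IntegrableOn (fun t : ℝ => t ^ (2 * n)) (Ioo 0 1) := fun n =>
    ((by fun_prop : Continuous fun t : ℝ => t ^ (2 * n)).continuousOn.integrableOn_Icc).mono_set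
      Ioo_subset_Icc_self
  have h := hasSum_integral_of_summable_integral_norm (μ := volume.restrict (Ioo (0 : ℝ) 1))
    (F := fun (n : ℕ) t => (-1 : ℝ) ^ n / (2 * n + 1) * t ^ (2 * n))
    (fun n => (hint n).const_mul _) (by
      refine summable_one_div_two_mul_add_one_sq.congr fun n => ?_
      have h1 : ∀ t : ℝ, ‖(-1 : ℝ) ^ n / (2 * n + 1) * t ^ (2 * n)‖ =
          1 / (2 * n + 1) * t ^ (2 * n) := fun t => by
        rw [norm_mul, norm_div, norm_pow, norm_neg, norm_one, one_pow,
          Real.norm_of_nonneg (by positivity), Real.norm_of_nonneg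
            (by rw [pow_mul]; positivity)]
      simp only [h1, integral_const_mul, integral_Ioo_pow]
      field_simp)
  rw [catalanConst, setIntegral_congr_fun measurableSet_Ioo fun t ht =>
    (hasSum_arctan_div ht).tsum_eq.symm, ← h.tsum_eq]
  congr 1
  funext n
  rw [integral_const_mul, integral_Ioo_pow]
  field_simp

/-- The substitution `θ = 2 arctan t`. -/
lemma integral_div_sin : ∫ θ in Ioo 0 (Real.pi / 2), θ / Real.sin θ = 2 * catalanConst := by
  have himage : (fun t => 2 * Real.arctan t) '' Ioo 0 1 = Ioo 0 (Real.pi / 2) := by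
    ext θ
    constructor
    · rintro ⟨t, ht, rfl⟩
      have h1 := Real.arctan_strictMono ht.1
      have h2 := Real.arctan_strictMono ht.2
      rw [Real.arctan_zero] at h1
      rw [Real.arctan_one] at h2
      constructor <;> simp only <;> linarith
    · intro hθ
      have hθ1 := hθ.1
      have hθ2 := hθ.2
      refine ⟨Real.tan (θ / 2), ⟨Real.tan_pos_of_pos_of_lt_pi_div_two (by linarith)
        (by linarith), ?_⟩, ?_⟩
      · rw [← Real.tan_pi_div_four]
        exact Real.tan_lt_tan_of_lt_of_lt_pi_div_two (by linarith) (by linarith [Real.pi_pos])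
          (by linarith)
      · simp only
        rw [Real.arctan_tan (by linarith) (by linarith)]
        ring
  rw [← himage, integral_image_eq_integral_abs_deriv_smul measurableSet_Ioo
    (fun t _ => ((Real.hasDerivAt_arctan t).const_mul 2).hasDerivWithinAt)
    (fun a _ b _ h => Real.arctan_injective (by simpa using h)),
    ← integral_arctan_div, ← integral_const_mul]
  refine setIntegral_congr_fun measurableSet_Ioo fun t ht => ?_
  have ht0 := ht.1
  have hsin : Real.sin (2 * Real.arctan t) = 2 * t / (1 + t ^ 2) := by
    rw [Real.sin_two_mul, Real.sin_arctan, Real.cos_arctan, mul_assoc, mul_div_assoc', mul_one,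
      div_div, Real.mul_self_sqrt (by positivity), mul_div_assoc']
  simp only [smul_eq_mul]
  rw [hsin, abs_of_pos (by positivity)]
  field_simp

lemma summable_binomCoeff_half_sq_div :
    Summable fun n : ℕ => binomCoeff (1 / 2) n ^ 2 / (2 * n + 1) := by
  refine ((summable_kernelCoeff (s := 1 / 2) (by norm_num) (by norm_num)).mul_left
    (3 / 2)).of_nonneg_of_le (fun n => by positivity) fun n => ?_
  rw [kernelCoeff, mul_div_assoc', div_le_div_iff₀ (by positivity) (by positivity)]
  nlinarith [sq_nonneg (binomCoeff (1 / 2) n), n.cast_nonneg (α := ℝ),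
    mul_nonneg (sq_nonneg (binomCoeff (1 / 2) n)) (n.cast_nonneg (α := ℝ))]

/-- Insert `binomCoeff (1 / 2) n = (2 / π) ∫ sin^(2n)` for one of the two factors and sum the
arcsine series under the integral sign. -/
lemma tsum_binomCoeff_half_sq_div :
    ∑' n : ℕ, binomCoeff (1 / 2) n ^ 2 / (2 * n + 1) = 4 * catalanConst / Real.pi := by
  have hval : ∀ n : ℕ, ∫ θ in Ioo 0 (Real.pi / 2), Real.sin θ ^ (2 * n) =
      Real.pi / 2 * binomCoeff (1 / 2) n := fun n => by
    rw [← integral_Ioc_eq_integral_Ioo, ← intervalIntegral.integral_of_le (by positivity),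
      integral_sin_pow_even_half]
  have hint : ∀ n : ℕ, IntegrableOn (fun θ => Real.sin θ ^ (2 * n)) (Ioo 0 (Real.pi / 2)) :=
    fun n => ((by fun_prop :
      Continuous fun θ => Real.sin θ ^ (2 * n)).continuousOn.integrableOn_Icc).mono_set
      Ioo_subset_Icc_self
  have hsum : Summable fun n : ℕ =>
      Real.pi / 2 * (binomCoeff (1 / 2) n ^ 2 / (2 * n + 1)) :=
    summable_binomCoeff_half_sq_div.mul_left _
  have h := hasSum_integral_of_summable_integral_norm
    (μ := volume.restrict (Ioo 0 (Real.pi / 2)))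
    (F := fun (n : ℕ) θ => binomCoeff (1 / 2) n / (2 * n + 1) * Real.sin θ ^ (2 * n))
    (fun n => (hint n).const_mul _) (by
      refine hsum.congr fun n => ?_
      have hc := binomCoeff_nonneg (s := 1 / 2) (by norm_num) n
      have h1 : ∀ θ : ℝ, ‖binomCoeff (1 / 2) n / (2 * n + 1) * Real.sin θ ^ (2 * n)‖ =
          binomCoeff (1 / 2) n / (2 * n + 1) * Real.sin θ ^ (2 * n) := fun θ =>
        Real.norm_of_nonneg (mul_nonneg (by positivity) (by rw [pow_mul]; positivity))
      simp only [h1, integral_const_mul, hval]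
      ring)
  rw [setIntegral_congr_fun measurableSet_Ioo fun θ hθ => (hasSum_div_sin hθ).tsum_eq,
    integral_div_sin] at h
  have h2 : (fun n : ℕ => ∫ θ in Ioo 0 (Real.pi / 2),
      binomCoeff (1 / 2) n / (2 * n + 1) * Real.sin θ ^ (2 * n)) =
      fun n : ℕ => Real.pi / 2 * (binomCoeff (1 / 2) n ^ 2 / (2 * n + 1)) := by
    funext n
    rw [integral_const_mul, hval]
    ring
  rw [h2] at h
  have h3 := h.tsum_eq
  rw [tsum_mul_left] at h3
  have := Real.pi_pos
  rw [eq_div_iff this.ne']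
  linarith

/-- With `d n = binomCoeff (1 / 2) n ^ 2`, the differences of `d n * n² / (n + 1/2)` are
`d n * ((1/4) / (n + 1/2) - 1 / (n + 3/2))`, and Wallis' product gives the limit `1 / π`. -/
lemma tsum_kernelCoeff_half :
    ∑' n, kernelCoeff (1 / 2) n =
      1 / Real.pi + (1 / 2) * ∑' n : ℕ, binomCoeff (1 / 2) n ^ 2 / (2 * n + 1) := by
  set B : ℕ → ℝ := fun n => binomCoeff (1 / 2) n ^ 2 * n ^ 2 / (n + 1 / 2) with hB
  have hk := summable_kernelCoeff (s := 1 / 2) (by norm_num) (by norm_num)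
  have hstep : ∀ n : ℕ, kernelCoeff (1 / 2) n -
      (1 / 2) * (binomCoeff (1 / 2) n ^ 2 / (2 * n + 1)) = B (n + 1) - B n := by
    intro n
    simp only [hB, kernelCoeff, binomCoeff_succ]
    push_cast
    field_simp
    ring
  have hsum := (hk.hasSum.sub (summable_binomCoeff_half_sq_div.hasSum.mul_left (1 / 2)))
  have hlim := hsum.tendsto_sum_nat
  simp only [hstep, Finset.sum_range_sub] at hlim
  have hBlim : Tendsto (fun n => B n - B 0) atTop (𝓝 (1 / Real.pi)) := by
    have h1 : Tendsto (fun n : ℕ => (n : ℝ) / (n + 1 / 2)) atTop (𝓝 1) :=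
      tendsto_natCast_div_add_atTop (1 / 2 : ℝ)
    have h2 := (tendsto_binomCoeff_half_sq.mul (h1.pow 2)).div_const 2
    have h3 : 2 / Real.pi * 1 ^ 2 / 2 = 1 / Real.pi := by ring
    rw [h3] at h2
    refine h2.congr fun n => ?_
    simp only [hB]
    push_cast
    field_simp
    ring
  linarith [tendsto_nhds_unique hlim hBlim]

lemma constA_one : constA 1 = (1 + 2 * catalanConst) / Real.pi := by
  rw [constA_eq_tsum_kernelCoeff one_pos, tsum_kernelCoeff_half, tsum_binomCoeff_half_sq_div]
  ring

theorem theorem3 :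
    -- for `2 < p ≤ ∞`, `J₀^*` is defined pointwise on `L^p(D)` and maps it into `L^∞(D)`
    (∀ p : ℝ≥0∞, 2 < p → ∀ f : ℂ → ℂ, MemLp f p diskArea →
      (∀ z ∈ Metric.ball (0 : ℂ) 1, Integrable (fun w => adjKernel z w * f w) diskArea) ∧
        MemLp (adjJ f) ∞ diskArea) ∧
    -- the hypergeometric series with these parameters converges at `1`, for the relevant `q`,
    -- and its sum is the limit of `₃F₂[…; x]` as `x → 1-`
    (∀ q : ℝ, 1 ≤ q → q < 2 →
      Summable (fun n : ℕ => hypCoeff (upperParams q) (lowerParams q) n * (1 : ℝ) ^ n) ∧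
        Tendsto (hypF (upperParams q) (lowerParams q)) (𝓝[<] 1)
          (𝓝 (hypF (upperParams q) (lowerParams q) 1))) ∧
    -- the norm for `2 < p < ∞`
    (∀ p : ℝ, 2 < p →
      adjJNorm (ENNReal.ofReal p) = ENNReal.ofReal (constA (p / (p - 1)) ^ (1 - 1 / p))) ∧
    -- the norm for `p = ∞` (where `q = 1`)
    adjJNorm ∞ = ENNReal.ofReal (constA 1) ∧
    adjJNorm ∞ = ENNReal.ofReal ((1 + 2 * catalanConst) / Real.pi) :=
  ⟨fun _ hp _ hf => ⟨fun _ hz => integrable_adjKernel_mul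
      (hf.integrable (ENNReal.one_lt_two.trans hp).le) (mem_ball_zero_iff.1 hz),
      memLp_adjJ_top_of_two_lt hp hf⟩,
    fun _ hq hq2 => hypergeometric_summable_and_tendsto (by linarith) hq2,
    fun _ hp => adjJNorm_ofReal hp, adjJNorm_top_eq_constA,
    adjJNorm_top_eq_constA.trans (by rw [constA_one])⟩
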